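/- Consider the infinite system $$\dot a_n(t)=(n-1)a_{n-1}(t)-n\,a_{n+1}(t),\qquad n=1,2,\dots,\quad a_0\equiv 0,\tag{B}$$ for real $a_n$. A solution for all time means differentiable functions $a_n:[0,\infty)\to\mathbb R$ satisfying (B) for all $t\ge 0$ whose generating functions $\sum_{n\ge0}a_{n+1}(t)z^n$ are analytic near $z=0$ locally uniformly in time, i.e. for every $T$ there are $C,\gamma$ with $|a_n(t)|\le C\gamma^n$ for all $n\ge1$, $t\in[0,T]$. **Theorem.** Let $(a_n(t))$ be a solution for all time which converges coordinatewise as $t\to\infty$ to a vector $(\bar a_1,\bar a_2,\dots)$ that is not the zero vector. Then $G_0(z)=\sum_{n\ge 0}a_{n+1}(0)z^n$ continues analytically to a neighborhood of $(-1,0]$. Denote the continuation again by $G_0$. 1. Suppose that $G_0$ has only a power-like singularity at $z=-1$: for some $A,\alpha\in\mathbb R$, the function $G_0(x)-A(1+x)^{-\alpha}$ has a finite limit as $x\to-1$ from the right along the real axis. Then $A\ne0$, $\alpha=\tfrac12$, and $$G_0(z)=\frac{A}{(1+z)^{1/2}}+\tilde G_0(z)$$ in a neighborhood of $(-1,0]$,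 where $\tilde G_0$ is analytic in a neighborhood of $(-1,0]$ and $\tilde G_0(x)$ has a finite limit as $x\to-1$ from the right along the real axis. Moreover $$\sum_{n=0}^\infty \bar a_{n+1}z^n=A\sqrt{\frac{2}{1-z^2}}\qquad(|z|<1).\tag{F}$$ 2. If one assumes only that $G_0(x)\sim A(1+x)^{-\alpha}$ as $x\to-1$ from the right along the real axis, for some real $A\neq0$ and $\alpha>0$, then still $\alpha=\tfrac12$ and (F) holds. 3. A real sequence $(b_1,b_2,\dots)$ is a fixed point of (B), that is $(n-1)b_{n-1}-n\,b_{n+1}=0$ for all $n\ge1$ (with $b_0=0$), if and only if there is $A\in\mathbb R$ with $\sum_{n\ge0}b_{n+1}z^n=A\sqrt{2/(1-z^2)}$ for $|z|<1$. Powers and square roots are principal branches. -/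

import Mathlib

open Filter Topology Set

namespace ShellModel

/-- The right-hand side `(n-1) b_{n-1} - n b_{n+1}` of the shell model, in coordinate `n ≥ 1`. -/
def field (b : ℕ → ℝ) (n : ℕ) : ℝ :=
  ((n : ℝ) - 1) * b (n - 1) - (n : ℝ) * b (n + 1)

/-- A solution on `[0, ∞)` of `a_n' = (n-1) a_{n-1} - n a_{n+1}`, `n ≥ 1`, with `a_0 = 0`.
The growth condition says that the generating functions `∑ a_{n+1}(t) z^n` are analytic near the
origin, locally uniformly in time.  It is what makes the initial value problem well posed: without
it every smooth function `a_1` of time can be completed to a solution of the equations. -/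
structure IsGlobalSolution (a : ℕ → ℝ → ℝ) : Prop where
  boundary : ∀ t : ℝ, 0 ≤ t → a 0 t = 0
  equation : ∀ n : ℕ, 1 ≤ n → ∀ t : ℝ, 0 ≤ t →
    HasDerivWithinAt (a n) (field (fun k => a k t) n) (Ici 0) t
  growth : ∀ T : ℝ, 0 ≤ T → ∃ C γ : ℝ, ∀ n : ℕ, 1 ≤ n → ∀ t ∈ Icc 0 T, |a n t| ≤ C * γ ^ n

/-- A fixed point: a vector at which the right-hand side vanishes in every coordinate. -/
def IsFixedPoint (b : ℕ → ℝ) : Prop :=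
  ∀ n : ℕ, 1 ≤ n → field b n = 0

/-- The real half-open interval `(-1, 0]`, inside `ℂ`. -/
def negInterval : Set ℂ := (fun x : ℝ => (x : ℂ)) '' Ioc (-1) 0

/-- `G` is the generating function `∑ b_{n+1} z^n`, summed near the origin and continued
analytically to a neighbourhood of `(-1, 0]`. -/
def IsGeneratingFunction (b : ℕ → ℝ) (G : ℂ → ℂ) : Prop :=
  AnalyticOnNhd ℂ G negInterval ∧
    ∀ᶠ z in 𝓝 (0 : ℂ), HasSum (fun n : ℕ => (b (n + 1) : ℂ) * z ^ n) (G z)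

/-- `F` has a finite limit at `-1` from the right along the real axis. -/
def HasFiniteLimit (F : ℂ → ℂ) : Prop :=
  ∃ c : ℝ, Tendsto (fun x : ℝ => F (x : ℂ)) (𝓝[>] (-1 : ℝ)) (𝓝 (c : ℂ))

/-- `∑ b_{n+1} z^n = A √(2 / (1 - z²))` on the open unit disk, with the principal square root
(note that `1 - z²` has positive real part there). -/
def HasFixedPointForm (b : ℕ → ℝ) (A : ℝ) : Prop :=
  ∀ z : ℂ, ‖z‖ < 1 →
    HasSum (fun n : ℕ => (b (n + 1) : ℂ) * z ^ n)
      ((A : ℂ) * (2 / (1 - z ^ 2)) ^ (1 / 2 : ℂ))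

end ShellModel

/-!
Write `Gₛ(z) = ∑ aₙ₊₁(s) zⁿ`. The functions `φₙ(u) = (-tanh u)ⁿ / cosh u` solve the adjoint system
with `φₙ(0) = δₙ₀`, so the pairing `∑ aₙ₊₁(r) φₙ(t - r)` does not depend on `r` between `s` and
`t`: the derivative of a partial sum telescopes to a boundary term, which the growth condition
makes small when `t` is close to `s`. Comparing `r = s` with `r = t` gives
`Gₛ(-tanh (t - s)) = a₁(t) cosh (t - s)` near `s`. Hence `a₁` is locally the restriction of a
complex analytic function, and these local extensions glue to one analytic function near `[0, ∞)`.
Then `a₁(artanh (-z)) / √(1 - z²)` continues `G₀` to a neighbourhood of `(-1, 0]`, and under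
`t = artanh (-x)` the limit `x → -1` becomes `t → ∞`.

Consequently `G₀(x) √(1 + x) → ā₁ / √2`. The limit vector is a fixed point, and a fixed point is
determined by its first coordinate, so `ā₁ ≠ 0`. Comparing powers of `1 + x` leaves `α = 1/2` and
`A = ā₁ / √2`.
-/

namespace ShellModel

theorem succ_mul_multichoose_succ {R : Type*} [CommRing R] [BinomialRing R] (a : R) (k : ℕ) :
    ((k : R) + 1) * Ring.multichoose a (k + 1) = (a + k) * Ring.multichoose a k := by
  have : IsAddTorsionFree R := BinomialRing.toIsAddTorsionFree
  apply nsmul_right_injective (Nat.factorial_ne_zero k)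
  have h := Ring.factorial_nsmul_multichoose_eq_ascPochhammer a (k + 1)
  rw [ascPochhammer_succ_right, Polynomial.smeval_mul,
    ← Ring.factorial_nsmul_multichoose_eq_ascPochhammer, Nat.factorial_succ] at h
  simp only [nsmul_eq_mul, Nat.cast_mul, Nat.cast_add, Nat.cast_one, Polynomial.smeval_add,
    Polynomial.smeval_X, Polynomial.smeval_natCast, pow_one, pow_zero, mul_one] at h ⊢
  linear_combination h

/-- The fixed point of the shell model with first coordinate `1`, indexed from `0`: the Taylor
coefficients of `(1 - z²)^(-1/2)`. -/
noncomputable def fixedPointCoeff : ℕ → ℝ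
  | 0 => 1
  | 1 => 0
  | n + 2 => (n + 1) / (n + 2) * fixedPointCoeff n

theorem field_one (b : ℕ → ℝ) : field b 1 = -b 2 := by simp [field]

theorem field_add_two (b : ℕ → ℝ) (n : ℕ) :
    field b (n + 2) = (n + 1) * b (n + 1) - (n + 2) * b (n + 3) := by
  simp only [field, Nat.cast_add, Nat.cast_ofNat, Nat.add_one_sub_one]
  ring

theorem isFixedPoint_iff_eq_mul_fixedPointCoeff {b : ℕ → ℝ} :
    IsFixedPoint b ↔ ∀ n, b (n + 1) = b 1 * fixedPointCoeff n := by
  constructor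
  · intro h n
    induction n using Nat.twoStepInduction with
    | zero => simp [fixedPointCoeff]
    | one => simpa [field_one, fixedPointCoeff] using h 1 le_rfl
    | more n ih _ =>
      have hrec := h (n + 2) (by omega)
      rw [field_add_two, ih] at hrec
      rw [fixedPointCoeff]
      field_simp
      linear_combination -hrec
  · rintro h (_ | _ | n) hn
    · contradiction
    · simp [field_one, h 1, fixedPointCoeff]
    · rw [field_add_two, h n, h (n + 2), fixedPointCoeff]
      field_simp
      ring

theorem fixedPointCoeff_two_mul (k : ℕ) :
    (fixedPointCoeff (2 * k) : ℂ) = Ring.multichoose (1 / 2 : ℂ) k := by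
  induction k with
  | zero => simp [fixedPointCoeff]
  | succ k ih =>
    have hk : (k : ℂ) + 1 ≠ 0 := k.cast_add_one_ne_zero
    rw [mul_add_one, fixedPointCoeff, Complex.ofReal_mul, ih]
    apply mul_left_cancel₀ hk
    rw [succ_mul_multichoose_succ]
    push_cast
    field_simp
    ring

theorem fixedPointCoeff_two_mul_add_one (k : ℕ) : fixedPointCoeff (2 * k + 1) = 0 := by
  induction k with
  | zero => simp [fixedPointCoeff]
  | succ k ih => rw [mul_add_one, add_right_comm, fixedPointCoeff, ih, mul_zero]

theorem hasSum_fixedPointCoeff_mul_pow {z : ℂ} (hz : ‖z‖ < 1) :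
    HasSum (fun n ↦ (fixedPointCoeff n : ℂ) * z ^ n) (1 / (1 - z ^ 2) ^ (1 / 2 : ℂ)) := by
  have hz2 : z ^ 2 ∈ Metric.eball (0 : ℂ) 1 := by
    rw [Metric.mem_eball, edist_zero_right, ← ofReal_norm, ENNReal.ofReal_lt_one, norm_pow]
    exact pow_lt_one₀ (norm_nonneg z) hz two_ne_zero
  have hbinom := (Complex.one_div_one_sub_cpow_hasFPowerSeriesOnBall_zero (1 / 2)).hasSum hz2
  have heven : Function.Injective (2 * · : ℕ → ℕ) := mul_right_injective₀ two_ne_zero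
  refine (heven.hasSum_iff fun n hn ↦ ?_).1 ?_
  · obtain ⟨k, rfl⟩ : Odd n := by
      rw [← Nat.not_even_iff_odd, even_iff_exists_two_mul]
      exact fun ⟨k, hk⟩ ↦ hn ⟨k, hk.symm⟩
    simp [fixedPointCoeff_two_mul_add_one]
  · simpa only [Function.comp_def, fixedPointCoeff_two_mul, Ring.multichoose_eq, pow_mul,
      FormalMultilinearSeries.ofScalars_apply_eq, smul_eq_mul, zero_add] using hbinom

theorem ofReal_div_cpow {r : ℝ} (hr : 0 < r) {w : ℂ} (hw : w ∈ Complex.slitPlane) (s : ℂ) :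
    ((r : ℂ) / w) ^ s = (r : ℂ) ^ s / w ^ s := by
  have hw0 := Complex.slitPlane_ne_zero hw
  have hr0 : (r : ℂ) ≠ 0 := Complex.ofReal_ne_zero.2 hr.ne'
  rw [div_eq_mul_inv, Complex.cpow_def_of_ne_zero (mul_ne_zero hr0 (inv_ne_zero hw0)),
    Complex.log_ofReal_mul hr (inv_ne_zero hw0),
    Complex.log_inv _ (Complex.mem_slitPlane_iff_arg.1 hw).1, Complex.cpow_def_of_ne_zero hr0,
    Complex.cpow_def_of_ne_zero hw0, ← Complex.exp_sub, Complex.ofReal_log hr.le]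
  ring_nf

theorem two_div_one_sub_sq_cpow_half {z : ℂ} (hz : ‖z‖ < 1) :
    (2 / (1 - z ^ 2)) ^ (1 / 2 : ℂ) = (√2 : ℝ) * (1 / (1 - z ^ 2) ^ (1 / 2 : ℂ)) := by
  have hslit : 1 - z ^ 2 ∈ Complex.slitPlane := by
    rw [sub_eq_add_neg]
    exact Complex.mem_slitPlane_of_norm_lt_one (by simpa using hz)
  have hsqrt : ((√2 : ℝ) : ℂ) = (2 : ℝ) ^ (1 / 2 : ℂ) := by
    rw [Real.sqrt_eq_rpow, Complex.ofReal_cpow zero_le_two]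
    norm_num
  rw [hsqrt, mul_one_div, ← ofReal_div_cpow two_pos hslit, Complex.ofReal_ofNat]

theorem hasFPowerSeriesAt_ofScalars {𝕜 : Type*} [NontriviallyNormedField 𝕜] {c : ℕ → 𝕜}
    {f : 𝕜 → 𝕜} (h : ∀ᶠ z in 𝓝 0, HasSum (fun n ↦ c n * z ^ n) (f z)) :
    HasFPowerSeriesAt f (FormalMultilinearSeries.ofScalars 𝕜 c) 0 := by
  rw [hasFPowerSeriesAt_iff]
  filter_upwards [h] with z hz
  simpa [FormalMultilinearSeries.coeff_ofScalars, mul_comm] using hz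

theorem hasFixedPointForm_iff_eq_mul_fixedPointCoeff {b : ℕ → ℝ} {A : ℝ} :
    HasFixedPointForm b A ↔ ∀ n, b (n + 1) = A * √2 * fixedPointCoeff n := by
  have hcoeff : ∀ z : ℂ, ‖z‖ < 1 →
      HasSum (fun n ↦ ((A * √2 * fixedPointCoeff n : ℝ) : ℂ) * z ^ n)
        (A * (2 / (1 - z ^ 2)) ^ (1 / 2 : ℂ)) := by
    intro z hz
    rw [two_div_one_sub_sq_cpow_half hz, ← mul_assoc]
    simpa [mul_assoc] using (hasSum_fixedPointCoeff_mul_pow hz).mul_left ((A : ℂ) * (√2 : ℝ))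
  refine ⟨fun h n ↦ ?_, fun h z hz ↦ by simpa only [h] using hcoeff z hz⟩
  have hdisk : ∀ᶠ z : ℂ in 𝓝 0, ‖z‖ < 1 := by
    simpa using eventually_norm_sub_lt (0 : ℂ) one_pos
  have hseries := (hasFPowerSeriesAt_ofScalars (hdisk.mono h)).eq_formalMultilinearSeries
    (hasFPowerSeriesAt_ofScalars (hdisk.mono hcoeff))
  exact_mod_cast congrFun ((FormalMultilinearSeries.ofScalars_series_eq_iff ℂ _ _).1 hseries) n

theorem IsFixedPoint.apply_one_ne_zero {b : ℕ → ℝ} (hb : IsFixedPoint b)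
    (hne : ∃ n, 1 ≤ n ∧ b n ≠ 0) : b 1 ≠ 0 := by
  obtain ⟨n, hn, hbn⟩ := hne
  rw [← Nat.sub_add_cancel hn, isFixedPoint_iff_eq_mul_fixedPointCoeff.1 hb] at hbn
  exact left_ne_zero_of_mul hbn

theorem IsFixedPoint.hasFixedPointForm {b : ℕ → ℝ} (hb : IsFixedPoint b) :
    HasFixedPointForm b (b 1 / √2) := by
  rw [hasFixedPointForm_iff_eq_mul_fixedPointCoeff, div_mul_cancel₀ _ (by positivity)]
  exact isFixedPoint_iff_eq_mul_fixedPointCoeff.1 hb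

theorem isFixedPoint_iff_exists_hasFixedPointForm {b : ℕ → ℝ} :
    IsFixedPoint b ↔ ∃ A : ℝ, HasFixedPointForm b A := by
  refine ⟨fun hb ↦ ⟨_, hb.hasFixedPointForm⟩, fun ⟨A, hA⟩ ↦ ?_⟩
  rw [hasFixedPointForm_iff_eq_mul_fixedPointCoeff] at hA
  refine isFixedPoint_iff_eq_mul_fixedPointCoeff.2 fun n ↦ ?_
  rw [hA n, hA 0, fixedPointCoeff, mul_one]

theorem hasDerivAt_tanh (u : ℝ) : HasDerivAt Real.tanh (1 - Real.tanh u ^ 2) u := by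
  have hcosh := (Real.cosh_pos u).ne'
  have htanh : Real.tanh = fun v ↦ Real.sinh v / Real.cosh v :=
    funext Real.tanh_eq_sinh_div_cosh
  rw [htanh]
  refine ((Real.hasDerivAt_sinh u).fun_div (Real.hasDerivAt_cosh u) hcosh).congr_deriv ?_
  field_simp

theorem abs_tanh_le_abs (u : ℝ) : |Real.tanh u| ≤ |u| := by
  have hderiv_le : ∀ v ∈ univ, ‖1 - Real.tanh v ^ 2‖ ≤ 1 := fun v _ ↦
    abs_le.2 ⟨by linarith [Real.tanh_sq_lt_one v], by linarith [sq_nonneg (Real.tanh v)]⟩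
  simpa using convex_univ.norm_image_sub_le_of_norm_hasDerivWithin_le
    (fun v _ ↦ (hasDerivAt_tanh v).hasDerivWithinAt) hderiv_le (mem_univ 0) (mem_univ u)

/-- The solution `φ` of the adjoint system `φₙ' = (n + 1) φₙ₊₁ - n φₙ₋₁` that starts at the first
basis vector. It is indexed from `0`, so that `φₙ` pairs with the coordinate `aₙ₊₁`. -/
noncomputable def adjointSolution (n : ℕ) (u : ℝ) : ℝ :=
  (-Real.tanh u) ^ n / Real.cosh u

theorem adjointSolution_apply_zero (n : ℕ) : adjointSolution n 0 = if n = 0 then 1 else 0 := by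
  simp [adjointSolution, zero_pow_eq]

theorem hasDerivAt_adjointSolution (n : ℕ) (u : ℝ) :
    HasDerivAt (adjointSolution n)
      ((n + 1) * adjointSolution (n + 1) u - n * adjointSolution (n - 1) u) u := by
  have hcosh := (Real.cosh_pos u).ne'
  have hsinh : Real.sinh u = Real.tanh u * Real.cosh u := by
    rw [Real.tanh_eq_sinh_div_cosh, div_mul_cancel₀ _ hcosh]
  refine (((hasDerivAt_tanh u).fun_neg.fun_pow n).fun_div (Real.hasDerivAt_cosh u)
    hcosh).congr_deriv ?_
  rcases n with _ | n
  · simp only [adjointSolution, hsinh]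
    field_simp
    simp
  · simp only [adjointSolution, hsinh, Nat.add_sub_cancel]
    push_cast
    field_simp
    ring

theorem abs_adjointSolution_le (n : ℕ) (u : ℝ) : |adjointSolution n u| ≤ |u| ^ n := by
  rw [adjointSolution, abs_div, abs_pow, abs_neg, abs_of_pos (Real.cosh_pos u)]
  calc |Real.tanh u| ^ n / Real.cosh u ≤ |Real.tanh u| ^ n :=
        div_le_self (by positivity) (Real.one_le_cosh u)
    _ ≤ |u| ^ n := pow_le_pow_left₀ (abs_nonneg _) (abs_tanh_le_abs u) n

theorem hasDerivWithinAt_sum_mul_adjointSolution {a : ℕ → ℝ → ℝ} (ha : IsGlobalSolution a) {r : ℝ}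
    (hr : 0 ≤ r) (t : ℝ) (N : ℕ) :
    HasDerivWithinAt (fun r ↦ ∑ n ∈ Finset.range N, a (n + 1) r * adjointSolution n (t - r))
      (-(N * (a N r * adjointSolution N (t - r) + a (N + 1) r * adjointSolution (N - 1) (t - r))))
      (Ici 0) r := by
  have hadjoint : ∀ n : ℕ, HasDerivWithinAt (fun r ↦ adjointSolution n (t - r))
      (-((n + 1) * adjointSolution (n + 1) (t - r) - n * adjointSolution (n - 1) (t - r)))
      (Ici 0) r := fun n ↦ by
    simpa using ((hasDerivAt_adjointSolution n (t - r)).comp_const_sub t r).hasDerivWithinAt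
  refine (HasDerivWithinAt.fun_sum fun n _ ↦
    (ha.equation (n + 1) (by omega) r hr).fun_mul (hadjoint n)).congr_deriv ?_
  induction N with
  | zero => simp
  | succ N ih =>
    rw [Finset.sum_range_succ, ih]
    simp only [field, Nat.add_sub_cancel]
    push_cast
    ring

theorem IsGlobalSolution.exists_abs_le {a : ℕ → ℝ → ℝ} (ha : IsGlobalSolution a) {T : ℝ}
    (hT : 0 ≤ T) :
    ∃ C γ : ℝ, 1 ≤ γ ∧ ∀ n, ∀ t ∈ Icc 0 T, |a (n + 1) t| ≤ C * γ ^ n := by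
  obtain ⟨C, γ, h⟩ := ha.growth T hT
  refine ⟨|C| * |γ|, max 1 |γ|, le_max_left _ _, fun n t ht ↦ ?_⟩
  calc |a (n + 1) t| ≤ C * γ ^ (n + 1) := h (n + 1) (by omega) t ht
    _ ≤ |C| * |γ| ^ (n + 1) := by rw [← abs_pow, ← abs_mul]; exact le_abs_self _
    _ = |C| * |γ| * |γ| ^ n := by ring
    _ ≤ |C| * |γ| * max 1 |γ| ^ n := by gcongr; exact le_max_right _ _

theorem abs_add_mul_adjointSolution_le {b : ℕ → ℝ} {C γ d u : ℝ} (hγ : 1 ≤ γ)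
    (hb : ∀ n, |b (n + 1)| ≤ C * γ ^ n) (hu : |u| ≤ d) (hd : d ≤ 1) (N : ℕ) :
    |b (N + 1) * adjointSolution (N + 1) u + b (N + 2) * adjointSolution N u| ≤
      2 * C * γ ^ (N + 1) * d ^ N := by
  have hC : 0 ≤ C := by simpa using (abs_nonneg _).trans (hb 0)
  have hφ : ∀ n, |adjointSolution n u| ≤ d ^ n := fun n ↦
    (abs_adjointSolution_le n u).trans (pow_le_pow_left₀ (abs_nonneg u) hu n)
  have hφ₁ : |adjointSolution (N + 1) u| ≤ d ^ N :=
    (hφ (N + 1)).trans (pow_le_pow_of_le_one ((abs_nonneg u).trans hu) hd N.le_succ)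
  have hb₁ : |b (N + 1)| ≤ C * γ ^ (N + 1) := (hb N).trans (by gcongr; omega)
  calc _ ≤ |b (N + 1)| * |adjointSolution (N + 1) u| + |b (N + 2)| * |adjointSolution N u| := by
        simpa only [← abs_mul] using abs_add_le _ _
    _ ≤ C * γ ^ (N + 1) * d ^ N + C * γ ^ (N + 1) * d ^ N := by
        gcongr
        exacts [hb (N + 1), hφ N]
    _ = 2 * C * γ ^ (N + 1) * d ^ N := by ring

theorem abs_sub_sum_mul_adjointSolution_le {a : ℕ → ℝ → ℝ} (ha : IsGlobalSolution a) {C γ s t : ℝ}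
    (hs : 0 ≤ s) (ht : 0 ≤ t) (hγ : 1 ≤ γ) (hbound : ∀ n, ∀ r ∈ uIcc s t, |a (n + 1) r| ≤ C * γ ^ n)
    (hst : γ * |t - s| ≤ 1) (N : ℕ) :
    |a 1 t - ∑ n ∈ Finset.range (N + 1), a (n + 1) s * adjointSolution n (t - s)| ≤
      2 * C * ((N + 1 : ℕ) * (γ * |t - s|) ^ (N + 1)) := by
  have hd : |t - s| ≤ 1 := (le_mul_of_one_le_left (abs_nonneg _) hγ).trans hst
  have hpos : ∀ r ∈ uIcc s t, 0 ≤ r := fun r hr ↦ (le_inf hs ht).trans hr.1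
  have hderiv : ∀ r ∈ uIcc s t, HasDerivWithinAt
      (fun r ↦ ∑ n ∈ Finset.range (N + 1), a (n + 1) r * adjointSolution n (t - r))
      (-((N + 1 : ℕ) * (a (N + 1) r * adjointSolution (N + 1) (t - r) +
        a (N + 2) r * adjointSolution N (t - r)))) (uIcc s t) r := fun r hr ↦
    (hasDerivWithinAt_sum_mul_adjointSolution ha (hpos r hr) t (N + 1)).mono hpos
  have hderiv_le : ∀ r ∈ uIcc s t,
      ‖-((N + 1 : ℕ) * (a (N + 1) r * adjointSolution (N + 1) (t - r) +
        a (N + 2) r * adjointSolution N (t - r)))‖ ≤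
        (N + 1 : ℕ) * (2 * C * γ ^ (N + 1) * |t - s| ^ N) := by
    intro r hr
    rw [norm_neg, norm_mul, Real.norm_natCast]
    gcongr
    exact abs_add_mul_adjointSolution_le (b := (a · r)) hγ (fun n ↦ hbound n r hr)
      (abs_sub_right_of_mem_uIcc hr) hd N
  have hmean := (convex_uIcc s t).norm_image_sub_le_of_norm_hasDerivWithin_le hderiv hderiv_le
    left_mem_uIcc right_mem_uIcc
  simp only [sub_self, adjointSolution_apply_zero, mul_ite, mul_one, mul_zero,
    Finset.sum_ite_eq', Finset.mem_range, N.succ_pos, if_true, zero_add, Real.norm_eq_abs] at hmean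
  exact hmean.trans_eq (by ring)

theorem hasSum_mul_neg_tanh_pow {a : ℕ → ℝ → ℝ} (ha : IsGlobalSolution a) {C γ s t : ℝ}
    (hs : 0 ≤ s) (ht : 0 ≤ t) (hγ : 1 ≤ γ) (hbound : ∀ n, ∀ r ∈ uIcc s t, |a (n + 1) r| ≤ C * γ ^ n)
    (hst : γ * |t - s| < 1) :
    HasSum (fun n ↦ a (n + 1) s * (-Real.tanh (t - s)) ^ n) (a 1 t * Real.cosh (t - s)) := by
  have hnonneg : 0 ≤ γ * |t - s| := by positivity
  have hsummable : Summable fun n ↦ a (n + 1) s * adjointSolution n (t - s) := by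
    refine .of_norm_bounded ((summable_geometric_of_lt_one hnonneg hst).mul_left C) fun n ↦ ?_
    rw [norm_mul, mul_pow, ← mul_assoc]
    exact mul_le_mul (hbound n s left_mem_uIcc) (abs_adjointSolution_le n _) (norm_nonneg _)
      ((abs_nonneg _).trans (hbound n s left_mem_uIcc))
  have herror : Tendsto (fun N : ℕ ↦ 2 * C * ((N + 1 : ℕ) * (γ * |t - s|) ^ (N + 1))) atTop
      (𝓝 0) := by
    simpa using ((tendsto_self_mul_const_pow_of_lt_one hnonneg hst).comp
      (tendsto_add_atTop_nat 1)).const_mul (2 * C)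
  have hsum : HasSum (fun n ↦ a (n + 1) s * adjointSolution n (t - s)) (a 1 t) := by
    rw [hsummable.hasSum_iff_tendsto_nat, ← tendsto_add_atTop_iff_nat 1]
    refine tendsto_iff_norm_sub_tendsto_zero.2 (squeeze_zero (fun _ ↦ norm_nonneg _) (fun N ↦ ?_)
      herror)
    rw [norm_sub_rev]
    exact abs_sub_sum_mul_adjointSolution_le ha hs ht hγ hbound hst.le N
  refine (hsum.mul_right (Real.cosh (t - s))).congr_fun fun n ↦ ?_
  rw [adjointSolution, mul_assoc, div_mul_cancel₀ _ (Real.cosh_pos _).ne']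

theorem eventually_hasSum_mul_neg_tanh_pow {a : ℕ → ℝ → ℝ} (ha : IsGlobalSolution a) {s : ℝ}
    (hs : 0 ≤ s) :
    ∀ᶠ t in 𝓝[Ici 0] s,
      HasSum (fun n ↦ a (n + 1) s * (-Real.tanh (t - s)) ^ n) (a 1 t * Real.cosh (t - s)) := by
  obtain ⟨C, γ, hγ, hbound⟩ := ha.exists_abs_le (T := s + 1) (by positivity)
  have hnear : ∀ᶠ t in 𝓝 s, t < s + 1 ∧ γ * |t - s| < 1 :=
    (eventually_lt_nhds (lt_add_one s)).and
      (ContinuousAt.eventually_lt (by fun_prop) continuousAt_const (by simp))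
  filter_upwards [self_mem_nhdsWithin, nhdsWithin_le_nhds hnear] with t ht ⟨hts, hγt⟩
  exact hasSum_mul_neg_tanh_pow ha hs ht hγ
    (fun n r hr ↦ hbound n r ⟨(le_inf hs ht).trans hr.1, hr.2.trans (by simp [hts.le])⟩) hγt

theorem exists_mem_ball_inter_ball_of_ordConnected {S : Set ℝ} (hS : S.OrdConnected) {x x' r r' : ℝ}
    (hx : x ∈ S) (hx' : x' ∈ S) (h : (Metric.ball (x : ℂ) r ∩ Metric.ball (x' : ℂ) r').Nonempty) :
    ∃ p ∈ S, (p : ℂ) ∈ Metric.ball (x : ℂ) r ∩ Metric.ball (x' : ℂ) r' := by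
  obtain ⟨z, hzx, hzx'⟩ := h
  have hre : |z.re - x| < r := by
    simpa using (Complex.abs_re_le_norm _).trans_lt (mem_ball_iff_norm.1 hzx)
  have hre' : |z.re - x'| < r' := by
    simpa using (Complex.abs_re_le_norm _).trans_lt (mem_ball_iff_norm.1 hzx')
  have hball : ∀ p y s : ℝ, |p - y| < s → (p : ℂ) ∈ Metric.ball (y : ℂ) s := fun p y s hp ↦ by
    rwa [mem_ball_iff_norm, ← Complex.ofReal_sub, Complex.norm_real]
  suffices ∃ p ∈ S, |p - x| < r ∧ |p - x'| < r' by
    obtain ⟨p, hp, hpx, hpx'⟩ := this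
    exact ⟨p, hp, hball _ _ _ hpx, hball _ _ _ hpx'⟩
  -- A point of the overlap whose real part is not in `S` projects outside the segment between the
  -- centres, and then the centre nearer to the projection lies in both balls.
  by_cases hz : z.re ∈ S
  · exact ⟨z.re, hz, hre, hre'⟩
  have hout : z.re ∉ uIcc x x' := fun h ↦ hz (hS.uIcc_subset hx hx' h)
  rcases le_total |z.re - x| |z.re - x'| with hle | hle
  · exact ⟨x, hx, by grind [uIcc], by grind [uIcc]⟩
  · exact ⟨x', hx', by grind [uIcc], by grind [uIcc]⟩

theorem frequently_nhdsNE_of_ordConnected {S : Set ℝ} (hS : S.OrdConnected) (hS' : S.Nontrivial)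
    {p : ℝ} (hp : p ∈ S) {P : ℂ → Prop} (h : ∀ᶠ y in 𝓝[S] p, P (y : ℝ)) :
    ∃ᶠ z in 𝓝[≠] (p : ℂ), P z := by
  have hacc := hS.isPreconnected.preperfect_of_nontrivial hS' p hp
  have hfreq : ∃ᶠ y in 𝓝[≠] p, P (y : ℝ) :=
    ((accPt_iff_frequently_nhdsNE.1 hacc).and_eventually
      (nhdsWithin_le_nhds (eventually_nhdsWithin_iff.1 h))).mono fun y hy ↦ hy.2 hy.1
  exact (Complex.continuous_ofReal.continuousAt.continuousWithinAt.tendsto_nhdsWithin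
    fun y hy ↦ Complex.ofReal_injective.ne hy).frequently hfreq

theorem eqOn_ball_inter_ball_of_ordConnected {E : Type*} [NormedAddCommGroup E] [NormedSpace ℂ E]
    {S : Set ℝ} (hS : S.OrdConnected) (hS' : S.Nontrivial) {x x' r r' : ℝ} (hx : x ∈ S)
    (hx' : x' ∈ S) {f f' : ℂ → E} (hf : AnalyticOnNhd ℂ f (Metric.ball x r))
    (hf' : AnalyticOnNhd ℂ f' (Metric.ball x' r'))
    (h : ∀ y ∈ S, (y : ℂ) ∈ Metric.ball (x : ℂ) r ∩ Metric.ball (x' : ℂ) r' → f y = f' y) :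
    EqOn f f' (Metric.ball (x : ℂ) r ∩ Metric.ball (x' : ℂ) r') := by
  rcases (Metric.ball (x : ℂ) r ∩ Metric.ball (x' : ℂ) r').eq_empty_or_nonempty with hempty | hne
  · simp [hempty]
  obtain ⟨p, hp, hpmem⟩ := exists_mem_ball_inter_ball_of_ordConnected hS hx hx' hne
  have hopen : IsOpen (Metric.ball (x : ℂ) r ∩ Metric.ball (x' : ℂ) r') :=
    Metric.isOpen_ball.inter Metric.isOpen_ball
  have hagree : ∀ᶠ y in 𝓝[S] p, f (y : ℝ) = f' y := by
    filter_upwards [self_mem_nhdsWithin, nhdsWithin_le_nhds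
      (Complex.continuous_ofReal.continuousAt.eventually_mem (hopen.mem_nhds hpmem))] using h
  exact (hf.mono inter_subset_left).eqOn_of_preconnected_of_frequently_eq
    (hf'.mono inter_subset_right)
    ((convex_ball (x : ℂ) r).inter (convex_ball (x' : ℂ) r')).isPreconnected hpmem
    (frequently_nhdsNE_of_ordConnected hS hS' hp hagree)

theorem exists_analyticOnNhd_eq_of_ordConnected {E : Type*} [NormedAddCommGroup E] [NormedSpace ℂ E]
    [CompleteSpace E] {S : Set ℝ} (hS : S.OrdConnected) (hS' : S.Nontrivial) {g : ℝ → E}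
    (h : ∀ x ∈ S, ∃ f : ℂ → E, AnalyticAt ℂ f x ∧ ∀ᶠ y in 𝓝[S] x, f (y : ℝ) = g y) :
    ∃ F : ℂ → E, AnalyticOnNhd ℂ F ((↑) '' S) ∧ ∀ x ∈ S, F x = g x := by
  have hball : ∀ x : S, ∃ r > 0, ∃ f : ℂ → E, AnalyticOnNhd ℂ f (Metric.ball (x : ℝ) r) ∧
      ∀ y ∈ S, (y : ℂ) ∈ Metric.ball ((x : ℝ) : ℂ) r → f y = g y := by
    rintro ⟨x, hx⟩
    obtain ⟨f, hf, hfg⟩ := h x hx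
    obtain ⟨r₁, hr₁, hf⟩ := hf.exists_ball_analyticOnNhd
    obtain ⟨r₂, hr₂, hfg⟩ := Metric.eventually_nhds_iff_ball.1 (eventually_nhdsWithin_iff.1 hfg)
    refine ⟨min r₁ r₂, lt_min hr₁ hr₂, f, hf.mono (Metric.ball_subset_ball (min_le_left _ _)),
      fun y hy hyx ↦ hfg y ?_ hy⟩
    rw [mem_ball_iff_norm, ← Complex.ofReal_sub, Complex.norm_real] at hyx
    exact mem_ball_iff_norm.2 (hyx.trans_le (min_le_right _ _))
  choose r hr f hf hfg using hball
  have hoverlap : ∀ x x' : S, EqOn (f x) (f x')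
      (Metric.ball ((x : ℝ) : ℂ) (r x) ∩ Metric.ball ((x' : ℝ) : ℂ) (r x')) := fun x x' ↦
    eqOn_ball_inter_ball_of_ordConnected hS hS' x.2 x'.2 (hf x) (hf x') fun y hy hyx ↦
      (hfg x y hy hyx.1).trans (hfg x' y hy hyx.2).symm
  classical
  let F : ℂ → E := fun z ↦
    if hz : ∃ x : S, z ∈ Metric.ball ((x : ℝ) : ℂ) (r x) then f hz.choose z else 0
  have hF : ∀ x : S, EqOn F (f x) (Metric.ball ((x : ℝ) : ℂ) (r x)) := fun x z hz ↦ by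
    have hex : ∃ x : S, z ∈ Metric.ball ((x : ℝ) : ℂ) (r x) := ⟨x, hz⟩
    simp only [F, dif_pos hex]
    exact hoverlap _ _ ⟨hex.choose_spec, hz⟩
  refine ⟨F, ?_, fun x hx ↦ ?_⟩
  · rintro _ ⟨x, hx, rfl⟩
    have hmem := Metric.ball_mem_nhds (x : ℂ) (hr ⟨x, hx⟩)
    exact (hf ⟨x, hx⟩ _ (mem_of_mem_nhds hmem)).congr
      ((hF ⟨x, hx⟩).eventuallyEq_of_mem hmem).symm
  · have hmem := Metric.mem_ball_self (x := (x : ℂ)) (hr ⟨x, hx⟩)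
    exact (hF ⟨x, hx⟩ hmem).trans (hfg ⟨x, hx⟩ x hx hmem)

/-- The sum of the power series `∑ bₙ₊₁ zⁿ`, wherever it converges. -/
noncomputable def genFun (b : ℕ → ℝ) (z : ℂ) : ℂ :=
  ∑' n, (b (n + 1) : ℂ) * z ^ n

theorem eventually_hasSum_genFun_of_abs_le {b : ℕ → ℝ} {C γ : ℝ} (hγ : 0 ≤ γ)
    (hb : ∀ n, |b (n + 1)| ≤ C * γ ^ n) :
    ∀ᶠ z in 𝓝 0, HasSum (fun n ↦ (b (n + 1) : ℂ) * z ^ n) (genFun b z) := by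
  have hnear : ∀ᶠ z : ℂ in 𝓝 0, γ * ‖z‖ < 1 :=
    ContinuousAt.eventually_lt (by fun_prop) continuousAt_const (by simp)
  filter_upwards [hnear] with z hz
  refine (Summable.of_norm_bounded
    ((summable_geometric_of_lt_one (by positivity) hz).mul_left C) fun n ↦ ?_).hasSum
  rw [norm_mul, norm_pow, Complex.norm_real, mul_pow, ← mul_assoc]
  gcongr
  exact hb n

theorem IsGlobalSolution.eventually_hasSum_genFun {a : ℕ → ℝ → ℝ} (ha : IsGlobalSolution a) {s : ℝ}
    (hs : 0 ≤ s) :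
    ∀ᶠ z in 𝓝 0, HasSum (fun n ↦ (a (n + 1) s : ℂ) * z ^ n) (genFun (a · s) z) := by
  obtain ⟨C, γ, hγ, hbound⟩ := ha.exists_abs_le hs
  exact eventually_hasSum_genFun_of_abs_le (zero_le_one.trans hγ) (hbound · s ⟨hs, le_rfl⟩)

theorem IsGlobalSolution.analyticAt_genFun {a : ℕ → ℝ → ℝ} (ha : IsGlobalSolution a) {s : ℝ}
    (hs : 0 ≤ s) : AnalyticAt ℂ (genFun (a · s)) 0 :=
  (hasFPowerSeriesAt_ofScalars (ha.eventually_hasSum_genFun hs)).analyticAt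

theorem IsGlobalSolution.eventually_genFun_neg_tanh {a : ℕ → ℝ → ℝ} (ha : IsGlobalSolution a)
    {s : ℝ} (hs : 0 ≤ s) :
    ∀ᶠ t in 𝓝[Ici 0] s,
      genFun (a · s) (-Real.tanh (t - s) : ℝ) = (a 1 t * Real.cosh (t - s) : ℝ) := by
  filter_upwards [eventually_hasSum_mul_neg_tanh_pow ha hs] with t ht
  simpa [genFun] using (Complex.hasSum_ofReal.2 ht).tsum_eq

theorem IsGlobalSolution.exists_analyticOnNhd_eq_first {a : ℕ → ℝ → ℝ} (ha : IsGlobalSolution a) :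
    ∃ H : ℂ → ℂ, AnalyticOnNhd ℂ H ((↑) '' Ici (0 : ℝ)) ∧ ∀ t : ℝ, 0 ≤ t → H t = a 1 t := by
  refine exists_analyticOnNhd_eq_of_ordConnected (g := fun t ↦ (a 1 t : ℂ)) ordConnected_Ici
    ((Ioi_infinite 0).mono Ioi_subset_Ici_self).nontrivial fun s hs ↦
    ⟨fun w ↦ genFun (a · s) (-(Complex.sinh (w - s) / Complex.cosh (w - s))) /
      Complex.cosh (w - s), ?_, ?_⟩
  · have hcosh_ne : Complex.cosh (s - s) ≠ 0 := by simp
    have hcosh : AnalyticAt ℂ (fun w ↦ Complex.cosh (w - s)) s := by fun_prop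
    have htanh : AnalyticAt ℂ (fun w ↦ -(Complex.sinh (w - s) / Complex.cosh (w - s))) s := by
      fun_prop (disch := assumption)
    exact ((ha.analyticAt_genFun hs).fun_comp_of_eq htanh (by simp)).fun_div hcosh hcosh_ne
  · filter_upwards [ha.eventually_genFun_neg_tanh hs] with t ht
    rw [← Complex.tanh_eq_sinh_div_cosh]
    push_cast at ht
    rw [ht, mul_div_cancel_right₀]
    exact_mod_cast (Real.cosh_pos (t - s)).ne'

/-- The principal branch of the inverse hyperbolic tangent, analytic off `(-∞, -1] ∪ [1, ∞)`. -/
noncomputable def complexArtanh (z : ℂ) : ℂ :=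
  Complex.log ((1 + z) / (1 - z)) / 2

theorem complexArtanh_ofReal {x : ℝ} (hx : x ∈ Ioo (-1) 1) : complexArtanh x = Real.artanh x := by
  have hpos : 0 < (1 + x) / (1 - x) := div_pos (by linarith [hx.1]) (by linarith [hx.2])
  rw [Real.artanh_eq_half_log ⟨hx.1.le, hx.2.le⟩, complexArtanh]
  push_cast [Complex.ofReal_log hpos.le]
  ring

theorem analyticAt_complexArtanh_ofReal {x : ℝ} (hx : x ∈ Ioo (-1) 1) :
    AnalyticAt ℂ complexArtanh x := by
  have hpos : 0 < (1 + x) / (1 - x) := div_pos (by linarith [hx.1]) (by linarith [hx.2])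
  have hne : (1 - x : ℂ) ≠ 0 := by exact_mod_cast (sub_pos.2 hx.2).ne'
  have hslit : (1 + x : ℂ) / (1 - x) ∈ Complex.slitPlane := by
    exact_mod_cast Complex.ofReal_mem_slitPlane.2 hpos
  unfold complexArtanh
  fun_prop (disch := assumption)

theorem neg_mem_Ioo_of_mem_Ioc {x : ℝ} (hx : x ∈ Ioc (-1) 0) : -x ∈ Ioo (-1 : ℝ) 1 :=
  ⟨by linarith [hx.2], by linarith [hx.1]⟩

theorem IsGlobalSolution.exists_analyticOnNhd_negInterval {a : ℕ → ℝ → ℝ}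
    (ha : IsGlobalSolution a) :
    ∃ F : ℂ → ℂ, AnalyticOnNhd ℂ F negInterval ∧ ∀ x : ℝ, x ∈ Ioc (-1) 0 →
      F x = (a 1 (Real.artanh (-x)) * Real.cosh (Real.artanh (-x)) : ℝ) := by
  obtain ⟨H, hH, hHa⟩ := ha.exists_analyticOnNhd_eq_first
  have hartanh : ∀ x ∈ Ioc (-1 : ℝ) 0, complexArtanh (-x) = Real.artanh (-x) := fun x hx ↦ by
    exact_mod_cast complexArtanh_ofReal (neg_mem_Ioo_of_mem_Ioc hx)
  have hnonneg : ∀ x ∈ Ioc (-1 : ℝ) 0, 0 ≤ Real.artanh (-x) := fun x hx ↦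
    Real.artanh_nonneg (neg_nonneg.2 hx.2)
  refine ⟨fun z ↦ H (complexArtanh (-z)) * Complex.cosh (complexArtanh (-z)), ?_, fun x hx ↦ ?_⟩
  · rintro _ ⟨x, hx, rfl⟩
    have hA : AnalyticAt ℂ (fun z : ℂ ↦ complexArtanh (-z)) x :=
      (analyticAt_complexArtanh_ofReal (neg_mem_Ioo_of_mem_Ioc hx)).fun_comp_of_eq
        analyticAt_id.neg (by simp)
    exact ((hH _ (mem_image_of_mem _ (hnonneg x hx))).fun_comp_of_eq hA (hartanh x hx)).mul
      (Complex.analyticAt_cosh.fun_comp hA)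
  · simp only [hartanh x hx, hHa _ (hnonneg x hx)]
    push_cast
    rfl

theorem tanh_pos {u : ℝ} (hu : 0 < u) : 0 < Real.tanh u := by
  rw [Real.tanh_eq_sinh_div_cosh]
  exact div_pos (Real.sinh_pos_iff.2 hu) (Real.cosh_pos u)

theorem tendsto_neg_tanh_nhdsNE :
    Tendsto (fun t : ℝ ↦ ((-Real.tanh t : ℝ) : ℂ)) (𝓝[>] 0) (𝓝[≠] 0) := by
  refine tendsto_nhdsWithin_iff.2 ⟨?_, ?_⟩
  · have htanh : ContinuousAt (fun t ↦ ((-Real.tanh t : ℝ) : ℂ)) 0 :=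
      Complex.continuous_ofReal.continuousAt.comp (hasDerivAt_tanh 0).continuousAt.neg
    simpa using htanh.tendsto.mono_left nhdsWithin_le_nhds
  · filter_upwards [self_mem_nhdsWithin] with t ht
    simpa [← Complex.ofReal_tanh] using (tanh_pos ht).ne'

theorem IsGlobalSolution.exists_isGeneratingFunction {a : ℕ → ℝ → ℝ} (ha : IsGlobalSolution a) :
    ∃ F : ℂ → ℂ, IsGeneratingFunction (a · 0) F ∧ ∀ x : ℝ, x ∈ Ioc (-1) 0 →
      F x = (a 1 (Real.artanh (-x)) * Real.cosh (Real.artanh (-x)) : ℝ) := by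
  obtain ⟨F, hF, hFa⟩ := ha.exists_analyticOnNhd_negInterval
  have htime : ∀ᶠ t in 𝓝[>] (0 : ℝ), F (-Real.tanh t : ℝ) = genFun (a · 0) (-Real.tanh t : ℝ) := by
    filter_upwards [nhdsWithin_mono 0 Ioi_subset_Ici_self (ha.eventually_genFun_neg_tanh le_rfl),
      self_mem_nhdsWithin] with t ht htpos
    rw [hFa _ ⟨neg_lt_neg (Real.tanh_lt_one t), (neg_neg_of_pos (tanh_pos htpos)).le⟩, neg_neg,
      Real.artanh_tanh]
    simpa using ht.symm
  have hagree : F =ᶠ[𝓝 0] genFun (a · 0) :=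
    ((hF 0 ⟨0, by simp, by simp⟩).frequently_eq_iff_eventually_eq
      (ha.analyticAt_genFun le_rfl)).1 (tendsto_neg_tanh_nhdsNE.frequently htime.frequently)
  refine ⟨F, ⟨hF, ?_⟩, hFa⟩
  filter_upwards [hagree, ha.eventually_hasSum_genFun le_rfl] with z hz hsum
  rwa [hz]

theorem IsGeneratingFunction.eqOn {b : ℕ → ℝ} {F G : ℂ → ℂ} (hF : IsGeneratingFunction b F)
    (hG : IsGeneratingFunction b G) : EqOn F G negInterval := by
  refine hF.1.eqOn_of_preconnected_of_eventuallyEq hG.1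
    (isPreconnected_Ioc.image _ Complex.continuous_ofReal.continuousOn) (z₀ := 0)
    ⟨0, by simp, by simp⟩ ?_
  filter_upwards [hF.2, hG.2] with z hFz hGz using hFz.unique hGz

theorem IsGeneratingFunction.apply_mul_sqrt {a : ℕ → ℝ → ℝ} {G : ℂ → ℂ}
    (hG : IsGeneratingFunction (a · 0) G) (ha : IsGlobalSolution a) {x : ℝ} (hx : x ∈ Ioc (-1) 0) :
    G x * (√(1 - x ^ 2) : ℝ) = a 1 (Real.artanh (-x)) := by
  obtain ⟨F, hF, hFa⟩ := ha.exists_isGeneratingFunction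
  have hpos : 0 < √(1 - x ^ 2) := Real.sqrt_pos.2 (by nlinarith [hx.1, hx.2])
  rw [hG.eqOn hF (mem_image_of_mem _ hx), hFa x hx, Real.cosh_artanh (neg_mem_Ioo_of_mem_Ioc hx),
    neg_sq, ← Complex.ofReal_mul, mul_one_div, div_mul_cancel₀ _ hpos.ne']

theorem eq_zero_of_tendsto_of_tendsto_deriv {E : Type*} [NormedAddCommGroup E] [NormedSpace ℝ E]
    {f f' : ℝ → E} {l c : E} (hderiv : ∀ᶠ t in atTop, HasDerivAt f (f' t) t)
    (hf : Tendsto f atTop (𝓝 l)) (hf' : Tendsto f' atTop (𝓝 c)) : c = 0 := by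
  have hzero : Tendsto (fun t ↦ f (t + 1) - f t) atTop (𝓝 0) := by
    simpa using (hf.comp (tendsto_atTop_add_const_right _ 1 tendsto_id)).sub hf
  have hc : Tendsto (fun t ↦ f (t + 1) - f t) atTop (𝓝 c) := by
    refine Metric.nhds_basis_closedBall.tendsto_right_iff.2 fun ε hε ↦ ?_
    have hsmall : ∀ᶠ t in atTop, ‖f' t - c‖ ≤ ε := by
      simpa [dist_eq_norm] using hf'.eventually_mem (Metric.closedBall_mem_nhds c hε)
    filter_upwards [eventually_forall_ge_atTop.2 (hderiv.and hsmall)] with t ht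
    have hmean := (convex_Ici t).norm_image_sub_le_of_norm_hasDerivWithin_le
      (f := fun s ↦ f s - s • c) (f' := fun s ↦ f' s - c) (C := ε)
      (fun s hs ↦ by
        simpa using ((ht s hs).1.fun_sub ((hasDerivAt_id s).smul_const c)).hasDerivWithinAt)
      (fun s hs ↦ (ht s hs).2) self_mem_Ici (show t + 1 ∈ Ici t by simp)
    rw [mem_closedBall_iff_norm]
    convert hmean using 1
    · simp only [add_smul, one_smul]
      congr 1
      abel
    · simp
  exact tendsto_nhds_unique hc hzero

theorem IsGlobalSolution.isFixedPoint_of_tendsto {a : ℕ → ℝ → ℝ} {abar : ℕ → ℝ}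
    (ha : IsGlobalSolution a) (hlim : ∀ n, 1 ≤ n → Tendsto (a n) atTop (𝓝 (abar n))) :
    IsFixedPoint abar := by
  intro n hn
  refine eq_zero_of_tendsto_of_tendsto_deriv (f' := fun t ↦ field (a · t) n) ?_ (hlim n hn) ?_
  · filter_upwards [eventually_gt_atTop 0] with t ht
    exact (ha.equation n hn t ht.le).hasDerivAt (Ici_mem_nhds ht)
  · rcases hn.eq_or_lt with rfl | hn1
    · simpa [field_one] using (hlim 2 one_le_two).neg
    · exact ((hlim (n - 1) (by omega)).const_mul _).sub ((hlim (n + 1) (by omega)).const_mul _)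

theorem tendsto_artanh_neg_atTop : Tendsto (fun x ↦ Real.artanh (-x)) (𝓝[>] (-1)) atTop := by
  refine tendsto_atTop.2 fun c ↦ ?_
  filter_upwards [Ioo_mem_nhdsGT (neg_lt_neg (Real.tanh_lt_one c))] with x hx
  calc c = Real.artanh (Real.tanh c) := (Real.artanh_tanh c).symm
    _ ≤ Real.artanh (-x) := Real.artanh_le_artanh (Real.neg_one_lt_tanh c) (by linarith [hx.1])
        (by linarith [hx.2])

theorem IsGeneratingFunction.tendsto_mul_sqrt_one_add {a : ℕ → ℝ → ℝ} {G : ℂ → ℂ} {l : ℝ}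
    (hG : IsGeneratingFunction (a · 0) G) (ha : IsGlobalSolution a)
    (hlim : Tendsto (a 1) atTop (𝓝 l)) :
    Tendsto (fun x : ℝ ↦ G x * (√(1 + x) : ℝ)) (𝓝[>] (-1)) (𝓝 (l / √2 : ℝ)) := by
  have hsqrt : Tendsto (fun x : ℝ ↦ √(1 - x)) (𝓝[>] (-1)) (𝓝 √2) := by
    have hcont : ContinuousAt (fun x : ℝ ↦ √(1 - x)) (-1) := by fun_prop
    simpa [one_add_one_eq_two] using hcont.tendsto.mono_left nhdsWithin_le_nhds
  refine (tendsto_ofReal_iff.2 ((hlim.comp tendsto_artanh_neg_atTop).div hsqrt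
    (by positivity))).congr' ?_
  filter_upwards [Ioo_mem_nhdsGT neg_one_lt_zero] with x hx
  have hpos : 0 < √(1 - x) := Real.sqrt_pos.2 (by linarith [hx.2])
  have hvalue := hG.apply_mul_sqrt ha ⟨hx.1, hx.2.le⟩
  rw [show 1 - x ^ 2 = (1 + x) * (1 - x) by ring, Real.sqrt_mul (by linarith [hx.1]),
    Complex.ofReal_mul, ← mul_assoc] at hvalue
  rw [Pi.div_apply, Complex.ofReal_div, Function.comp_apply, ← hvalue,
    mul_div_cancel_right₀ _ (Complex.ofReal_ne_zero.2 hpos.ne')]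

theorem eq_zero_and_eq_of_tendsto_mul_rpow {ι : Type*} {L : Filter ι} [L.NeBot] {u : ι → ℝ}
    {A β c : ℝ} (hu : Tendsto u L (𝓝[>] 0)) (hc : c ≠ 0)
    (h : Tendsto (fun i ↦ A * u i ^ β) L (𝓝 c)) : β = 0 ∧ A = c := by
  have hpow : ∀ {s : ℝ}, 0 < s → Tendsto (fun i ↦ u i ^ s) L (𝓝 0) := fun {s} hs ↦ by
    simpa [Real.zero_rpow hs.ne'] using
      (hu.mono_right nhdsWithin_le_nhds).rpow_const (Or.inr hs.le)
  rcases lt_trichotomy β 0 with hβ | rfl | hβ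
  · have hconst : Tendsto (fun _ ↦ A) L (𝓝 0) := by
      refine (mul_zero c ▸ h.mul (hpow (neg_pos.2 hβ))).congr' ?_
      filter_upwards [hu self_mem_nhdsWithin] with i hi
      rw [mul_assoc, ← Real.rpow_add hi, add_neg_cancel, Real.rpow_zero, mul_one]
    obtain rfl : A = 0 := tendsto_nhds_unique tendsto_const_nhds hconst
    exact absurd (tendsto_nhds_unique h (by simp)) hc
  · simp only [Real.rpow_zero, mul_one] at h
    exact ⟨rfl, tendsto_nhds_unique tendsto_const_nhds h⟩
  · exact absurd (tendsto_nhds_unique h (by simpa using (hpow hβ).const_mul A)) hc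

theorem tendsto_one_add_nhdsGT_neg_one : Tendsto (fun x : ℝ ↦ 1 + x) (𝓝[>] (-1)) (𝓝[>] 0) := by
  refine tendsto_nhdsWithin_iff.2 ⟨?_, ?_⟩
  · have hcont : ContinuousAt (fun x : ℝ ↦ 1 + x) (-1) := by fun_prop
    simpa using hcont.tendsto.mono_left nhdsWithin_le_nhds
  · filter_upwards [self_mem_nhdsWithin] with x hx
    exact neg_lt_iff_pos_add'.1 (mem_Ioi.1 hx)

theorem one_add_cpow_mul_sqrt {x : ℝ} (hx : -1 < x) (α : ℝ) :
    (1 + (x : ℂ)) ^ (-(α : ℂ)) * (√(1 + x) : ℝ) = ((1 + x) ^ (1 / 2 - α) : ℝ) := by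
  have hpos : 0 < 1 + x := neg_lt_iff_pos_add'.1 hx
  have hcpow : (1 + (x : ℂ)) ^ (-(α : ℂ)) = ((1 + x) ^ (-α) : ℝ) := by
    rw [Complex.ofReal_cpow hpos.le]
    push_cast
    rfl
  rw [hcpow, Real.sqrt_eq_rpow, ← Complex.ofReal_mul, ← Real.rpow_add hpos, neg_add_eq_sub]

theorem eq_half_and_eq_of_tendsto_mul_cpow {A α l : ℝ} (hl : l ≠ 0)
    (h : Tendsto (fun x : ℝ ↦ (A : ℂ) * (1 + (x : ℂ)) ^ (-(α : ℂ)) * (√(1 + x) : ℝ)) (𝓝[>] (-1))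
      (𝓝 (l : ℂ))) : α = 1 / 2 ∧ A = l := by
  have hreal : Tendsto (fun x : ℝ ↦ A * (1 + x) ^ (1 / 2 - α)) (𝓝[>] (-1)) (𝓝 l) := by
    refine tendsto_ofReal_iff.1 (h.congr' ?_)
    filter_upwards [self_mem_nhdsWithin] with x hx
    rw [mul_assoc, one_add_cpow_mul_sqrt hx, Complex.ofReal_mul]
  obtain ⟨hα, hA⟩ := eq_zero_and_eq_of_tendsto_mul_rpow tendsto_one_add_nhdsGT_neg_one hl hreal
  exact ⟨(sub_eq_zero.1 hα).symm, hA⟩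

theorem HasFiniteLimit.tendsto_mul_sqrt_one_add {F : ℂ → ℂ} (hF : HasFiniteLimit F) :
    Tendsto (fun x : ℝ ↦ F x * (√(1 + x) : ℝ)) (𝓝[>] (-1)) (𝓝 0) := by
  obtain ⟨c, hc⟩ := hF
  have hsqrt : Tendsto (fun x : ℝ ↦ √(1 + x)) (𝓝[>] (-1)) (𝓝 0) := by
    simpa using (tendsto_one_add_nhdsGT_neg_one.mono_right nhdsWithin_le_nhds).sqrt
  simpa using hc.mul (tendsto_ofReal_iff.2 hsqrt)

theorem analyticOnNhd_div_one_add_cpow (A s : ℂ) :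
    AnalyticOnNhd ℂ (fun z ↦ A / (1 + z) ^ s) negInterval := by
  rintro _ ⟨x, hx, rfl⟩
  have hslit : 1 + (x : ℂ) ∈ Complex.slitPlane := by
    exact_mod_cast Complex.ofReal_mem_slitPlane.2 (neg_lt_iff_pos_add'.1 hx.1)
  refine AnalyticAt.fun_div (by fun_prop) (by fun_prop (disch := assumption)) ?_
  simp [Complex.cpow_eq_zero_iff, Complex.slitPlane_ne_zero hslit]

theorem div_one_add_cpow_half (A z : ℂ) :
    A / (1 + z) ^ (1 / 2 : ℂ) = A * (1 + z) ^ (-((1 / 2 : ℝ) : ℂ)) := by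
  rw [Complex.cpow_neg, div_eq_mul_inv]
  norm_num

theorem IsGeneratingFunction.eq_half_and_eq_of_hasFiniteLimit_sub {a : ℕ → ℝ → ℝ} {G : ℂ → ℂ}
    {A α l : ℝ} (hG : IsGeneratingFunction (a · 0) G) (ha : IsGlobalSolution a)
    (hlim : Tendsto (a 1) atTop (𝓝 l)) (hl : l ≠ 0)
    (h : HasFiniteLimit (fun z ↦ G z - (A : ℂ) * (1 + z) ^ (-(α : ℂ)))) :
    α = 1 / 2 ∧ A = l / √2 := by
  refine eq_half_and_eq_of_tendsto_mul_cpow (by positivity) ?_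
  simpa [sub_mul] using (hG.tendsto_mul_sqrt_one_add ha hlim).sub h.tendsto_mul_sqrt_one_add

theorem IsGeneratingFunction.eq_half_and_eq_of_isEquivalent {a : ℕ → ℝ → ℝ} {G : ℂ → ℂ}
    {A α l : ℝ} (hG : IsGeneratingFunction (a · 0) G) (ha : IsGlobalSolution a)
    (hlim : Tendsto (a 1) atTop (𝓝 l)) (hl : l ≠ 0)
    (h : Asymptotics.IsEquivalent (𝓝[>] (-1 : ℝ)) (fun x : ℝ ↦ G x)
      (fun x : ℝ ↦ (A : ℂ) * (1 + (x : ℂ)) ^ (-(α : ℂ)))) :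
    α = 1 / 2 ∧ A = l / √2 :=
  eq_half_and_eq_of_tendsto_mul_cpow (by positivity) <|
    (h.mul Asymptotics.IsEquivalent.refl).tendsto_nhds (hG.tendsto_mul_sqrt_one_add ha hlim)

end ShellModel

theorem mainTheorem6 :
    (∀ (a : ℕ → ℝ → ℝ) (abar : ℕ → ℝ),
      ShellModel.IsGlobalSolution a →
      (∀ n : ℕ, 1 ≤ n → Tendsto (a n) atTop (𝓝 (abar n))) →
      (∃ n : ℕ, 1 ≤ n ∧ abar n ≠ 0) →
      (∃ G₀ : ℂ → ℂ, ShellModel.IsGeneratingFunction (fun n => a n 0) G₀) ∧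
      ∀ G₀ : ℂ → ℂ, ShellModel.IsGeneratingFunction (fun n => a n 0) G₀ →
        (∀ A α : ℝ,
          ShellModel.HasFiniteLimit (fun z => G₀ z - (A : ℂ) * (1 + z) ^ (-(α : ℂ))) →
          A ≠ 0 ∧ α = 1 / 2 ∧
          (∃ Gt : ℂ → ℂ,
            AnalyticOnNhd ℂ Gt ShellModel.negInterval ∧
            ShellModel.HasFiniteLimit Gt ∧
            ∀ᶠ z in 𝓝ˢ ShellModel.negInterval,
              G₀ z = (A : ℂ) / (1 + z) ^ (1 / 2 : ℂ) + Gt z) ∧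
          ShellModel.HasFixedPointForm abar A) ∧
        (∀ A α : ℝ, A ≠ 0 → 0 < α →
          Asymptotics.IsEquivalent (𝓝[>] (-1 : ℝ)) (fun x : ℝ => G₀ (x : ℂ))
            (fun x : ℝ => (A : ℂ) * (1 + (x : ℂ)) ^ (-(α : ℂ))) →
          α = 1 / 2 ∧ ShellModel.HasFixedPointForm abar A)) ∧
    (∀ b : ℕ → ℝ, b 0 = 0 →
      (ShellModel.IsFixedPoint b ↔ ∃ A : ℝ, ShellModel.HasFixedPointForm b A)) := by
  refine ⟨fun a abar ha hlim hne ↦ ?_, fun b _ ↦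
    ShellModel.isFixedPoint_iff_exists_hasFixedPointForm⟩
  have hfix : ShellModel.IsFixedPoint abar := ha.isFixedPoint_of_tendsto hlim
  have hone : abar 1 ≠ 0 := hfix.apply_one_ne_zero hne
  have hlim_one : Tendsto (a 1) atTop (𝓝 (abar 1)) := hlim 1 le_rfl
  obtain ⟨F, hF, -⟩ := ha.exists_isGeneratingFunction
  refine ⟨⟨F, hF⟩, fun G₀ hG ↦ ⟨fun A α hpower ↦ ?_, fun A α _ _ hequiv ↦ ?_⟩⟩
  · obtain ⟨rfl, rfl⟩ := hG.eq_half_and_eq_of_hasFiniteLimit_sub ha hlim_one hone hpower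
    simp only [← ShellModel.div_one_add_cpow_half] at hpower
    exact ⟨by positivity, rfl,
      ⟨_, hG.1.sub (ShellModel.analyticOnNhd_div_one_add_cpow _ _), hpower,
        .of_forall fun z ↦ (add_sub_cancel _ _).symm⟩,
      hfix.hasFixedPointForm⟩
  · obtain ⟨rfl, rfl⟩ := hG.eq_half_and_eq_of_isEquivalent ha hlim_one hone hequiv
    exact ⟨rfl, hfix.hasFixedPointForm⟩
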